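/- All spaces are assumed to be Hausdorff. A space $X$ is \emph{feebly compact} if each locally finite family of open subsets of $X$ is finite. For a class $\mathcal C$ of spaces, a space $X$ is \emph{locally $\mathcal C$} if each point of $X$ has a closed neighborhood which, as a subspace of $X$, belongs to $\mathcal C$. A topological group $G$ is \emph{monothetic} if it contains a dense cyclic subsemigroup, that is, $G=\overline{\{a^n:n\ge 1\}}$ for some $a\in G$. Let $\mathcal C$ be a class of feebly compact spaces with the following two properties. (1) $\mathcal C$ is closed with respect to homeomorphisms. (2) A space $X$ belongs to $\mathcal C$ provided there exist finitely many subspaces $X_1,\dots,X_n\in\mathcal C$ of $X$ ($n\ge 1$) such that for any point $x\in X$ some $X_i$ is a neighborhood of $x$ in $X$. Then each locally $\mathcal C$ monothetic topological group $G$ belongs to $\mathcal C$. -/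

import Mathlib

open Topology

universe u

/-- A space is feebly compact if each locally finite family of its open subsets is finite. -/
def FeeblyCompact (X : Type u) [TopologicalSpace X] : Prop :=
  ∀ 𝒰 : Set (Set X), (∀ U ∈ 𝒰, IsOpen U) →
    LocallyFinite (fun U : 𝒰 => (U : Set X)) → 𝒰.Finite

/-- A class of Hausdorff spaces. -/
abbrev SpaceClass : Type (u + 1) :=
  ∀ (X : Type u) [TopologicalSpace X] [T2Space X], Prop

/-- The class `C` is closed with respect to homeomorphisms. -/
def SpaceClass.ClosedUnderHomeomorphisms (C : SpaceClass.{u}) : Prop :=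
  ∀ (X Y : Type u) [TopologicalSpace X] [T2Space X] [TopologicalSpace Y] [T2Space Y],
    Nonempty (X ≃ₜ Y) → C X → C Y

/-- A Hausdorff space `X` belongs to `C` as soon as there are finitely many subspaces
`Y 0, …, Y (n - 1)` of `X`, `n ≥ 1`, all in `C`, such that each point of `X` has one of them
as a (not necessarily open) neighborhood. -/
def SpaceClass.ClosedUnderNeighborhoodCovers (C : SpaceClass.{u}) : Prop :=
  ∀ (X : Type u) [TopologicalSpace X] [T2Space X] (n : ℕ) (Y : Fin n → Set X), 1 ≤ n →
    (∀ i, C (Y i)) → (∀ x : X, ∃ i, Y i ∈ 𝓝 x) → C X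

/-- A space is locally `C` if each of its points has a closed neighborhood which, as a subspace,
is in the class `C`. -/
def SpaceClass.Locally (C : SpaceClass.{u}) (X : Type u) [TopologicalSpace X] [T2Space X] : Prop :=
  ∀ x : X, ∃ W : Set X, W ∈ 𝓝 x ∧ IsClosed W ∧ C W

/-- A topologized monoid `S` is monothetic if the cyclic subsemigroup `{a ^ n : n ≥ 1}`
(positive powers only) is dense in `S` for some `a`. -/
def Monothetic (S : Type u) [Monoid S] [TopologicalSpace S] : Prop :=
  ∃ a : S, Dense {x : S | ∃ n : ℕ, 1 ≤ n ∧ x = a ^ n}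

open scoped Pointwise

/-! A feebly compact neighborhood `W` of 1 has totally bounded interior, which bounds the first time
`k ≥ 1` at which `g⁻¹ * a ^ k` is near 1, uniformly in `g`: that element is close to a point `x` of
a finite net, and `x` to some `a ^ e x`, so if `k > e x` then `g⁻¹ * a ^ (k - e x)` is already near
1. Hence finitely many translates `a ^ k * W` are neighborhoods covering `G`. -/

/-- The interior of a feebly compact subspace of a topological group is totally bounded: it is
covered by finitely many right translates of any neighborhood of the identity. -/
theorem FeeblyCompact.interior_subset_finite_translates {G : Type u} [Group G]
    [TopologicalSpace G] [IsTopologicalGroup G] {W : Set G} (hW : FeeblyCompact W)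
    {V : Set G} (hV : V ∈ 𝓝 (1 : G)) :
    ∃ s : Finset G, ∀ y ∈ interior W, ∃ x ∈ s, y * x⁻¹ ∈ V := by
  by_contra! hcon
  obtain ⟨x, hxW, hx⟩ := exists_seq_of_forall_finset_exists (· ∈ interior W)
    (fun x y : G => y * x⁻¹ ∉ V) (fun s _ => hcon s)
  obtain ⟨O', hO', hO'V⟩ := exists_nhds_one_split4 hV
  obtain ⟨O, hO, hOopen, hOinv, hOO'⟩ : ∃ O : Set G, (1 : G) ∈ O ∧ IsOpen O ∧
      (∀ z ∈ O, z⁻¹ ∈ O) ∧ O ⊆ O' := by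
    refine ⟨interior O' ∩ (interior O')⁻¹, ?_, isOpen_interior.inter isOpen_interior.inv, ?_, ?_⟩
    · have := mem_interior_iff_mem_nhds.2 hO'
      exact ⟨this, by simpa using this⟩
    · rintro z ⟨h₁, h₂⟩
      exact ⟨h₂, by simpa using h₁⟩
    · exact fun z hz => interior_subset hz.1
  let A : ℕ → Set W := fun n => {w | (w : G) ∈ interior W ∧ (w : G) * (x n)⁻¹ ∈ O}
  have hAopen (n : ℕ) : IsOpen (A n) :=
    (isOpen_interior.preimage continuous_subtype_val).inter
      (hOopen.preimage (continuous_subtype_val.mul continuous_const))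
  -- A translate of `O` meets at most one member of the family.
  have hmeet (p : W) (m n : ℕ) (hmn : m < n)
      (hm : (A m ∩ {w : W | (w : G) * (p : G)⁻¹ ∈ O}).Nonempty)
      (hn : (A n ∩ {w : W | (w : G) * (p : G)⁻¹ ∈ O}).Nonempty) : False := by
    obtain ⟨v, ⟨-, hv₁⟩, hv₂⟩ := hm
    obtain ⟨w, ⟨-, hw₁⟩, hw₂⟩ := hn
    apply hx m n hmn
    -- Telescopes: `(x n * w⁻¹) * (w * p⁻¹) * (p * v⁻¹) * (v * (x m)⁻¹) = x n * (x m)⁻¹`.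
    have := hO'V (hOO' (hOinv _ hw₁)) (hOO' hw₂) (hOO' (hOinv _ hv₂)) (hOO' hv₁)
    simpa [mul_assoc] using this
  have hAfin : LocallyFinite A := by
    intro p
    refine ⟨{w : W | (w : G) * (p : G)⁻¹ ∈ O}, ?_, ?_⟩
    · exact (hOopen.preimage (continuous_subtype_val.mul continuous_const)).mem_nhds
        (by simpa using hO)
    · refine Set.Subsingleton.finite fun m hm n hn => ?_
      rcases lt_trichotomy m n with h | h | h
      · exact (hmeet p m n h hm hn).elim
      · exact h
      · exact (hmeet p n m h hn hm).elim
  have hAmem (n : ℕ) : (⟨x n, interior_subset (hxW n)⟩ : W) ∈ A n := ⟨hxW n, by simpa using hO⟩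
  -- Feeble compactness concerns sets of open sets, so the `A n` must be distinct.
  have hAne (m n : ℕ) (hmn : m < n) : A m ≠ A n := by
    intro h
    have hn := hAmem n
    have hm := h ▸ hn
    exact hmeet ⟨x n, interior_subset (hxW n)⟩ m n hmn ⟨_, hm, by simpa using hO⟩
      ⟨_, hn, by simpa using hO⟩
  have hAinj : Function.Injective A := by
    intro m n h
    by_contra hne
    rcases lt_or_gt_of_ne hne with h' | h'
    · exact hAne m n h' h
    · exact hAne n m h' h.symm
  refine Set.infinite_range_of_injective hAinj (hW (Set.range A) ?_ hAfin.on_range)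
  rintro _ ⟨n, rfl⟩
  exact hAopen n

/-- If the positive powers of `a` are dense and some neighborhood `W` of the identity is a feebly
compact subspace, then finitely many translates of `interior W` by positive powers of `a` cover
the group. -/
theorem FeeblyCompact.exists_pow_translates_cover {G : Type u} [Group G] [TopologicalSpace G]
    [IsTopologicalGroup G] {a : G} (ha : Dense {x : G | ∃ n : ℕ, 1 ≤ n ∧ x = a ^ n})
    {W : Set G} (hW : FeeblyCompact W) (hW1 : W ∈ 𝓝 (1 : G)) :
    ∃ N : ℕ, ∀ g : G, ∃ k ≤ N, (a ^ k)⁻¹ * g ∈ interior W := by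
  have hreach {V : Set G} (hV : V ∈ 𝓝 (1 : G)) (g : G) : ∃ n : ℕ, 1 ≤ n ∧ g⁻¹ * a ^ n ∈ V := by
    have : (fun z => g⁻¹ * z) ⁻¹' V ∈ 𝓝 g :=
      (continuous_const.mul continuous_id).continuousAt.preimage_mem_nhds (by simpa using hV)
    obtain ⟨_, ⟨n, hn, rfl⟩, hz⟩ := ha.inter_nhds_nonempty this
    exact ⟨n, hn, hz⟩
  have hreach' {V : Set G} (hV : V ∈ 𝓝 (1 : G)) (g : G) : ∃ n : ℕ, 1 ≤ n ∧ g * (a ^ n)⁻¹ ∈ V := by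
    have : (fun z => g * z⁻¹) ⁻¹' V ∈ 𝓝 g :=
      (continuous_const.mul continuous_inv).continuousAt.preimage_mem_nhds (by simpa using hV)
    obtain ⟨_, ⟨n, hn, rfl⟩, hz⟩ := ha.inter_nhds_nonempty this
    exact ⟨n, hn, hz⟩
  have hU : interior W ∈ 𝓝 (1 : G) := interior_mem_nhds.2 hW1
  -- One factor puts `g⁻¹ * a ^ k` within reach of the net, the other gives the cover.
  let V : Set G := interior W ∩ (interior W)⁻¹
  have hV : V ∈ 𝓝 (1 : G) := Filter.inter_mem hU (inv_mem_nhds_one G hU)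
  obtain ⟨O, hO, hOV⟩ := exists_nhds_one_split hV
  obtain ⟨s, hs⟩ := hW.interior_subset_finite_translates hO
  choose e he1 heO using fun x => hreach' hO x
  refine ⟨s.sup e, fun g => ?_⟩
  classical
  have hex := hreach hV g
  obtain ⟨hk1, hkV⟩ := Nat.find_spec hex
  refine ⟨Nat.find hex, ?_, by simpa using hkV.2⟩
  obtain ⟨x, hxs, hx⟩ := hs _ hkV.1
  refine le_trans ?_ (Finset.le_sup (f := e) hxs)
  by_contra! hlt
  -- `e x ≥ 1` makes the exponent smaller; `hlt` keeps it positive.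
  refine Nat.find_min hex (m := Nat.find hex - e x) (by have := he1 x; omega) ⟨by omega, ?_⟩
  have := hOV _ hx _ (heO x)
  rw [pow_sub a hlt.le]
  simpa [mul_assoc] using this

theorem mainTheorem10 (C : SpaceClass.{u})
    (hfeebly : ∀ (X : Type u) [TopologicalSpace X] [T2Space X], C X → FeeblyCompact X)
    (hhomeo : C.ClosedUnderHomeomorphisms)
    (hcover : C.ClosedUnderNeighborhoodCovers)
    (G : Type u) [Group G] [TopologicalSpace G] [IsTopologicalGroup G] [T2Space G]
    (hmono : Monothetic G) (hlocal : C.Locally G) :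
    C G := by
  obtain ⟨a, ha⟩ := hmono
  obtain ⟨W, hW1, -, hCW⟩ := hlocal 1
  obtain ⟨N, hN⟩ := (hfeebly W hCW).exists_pow_translates_cover ha hW1
  refine hcover G (N + 1) (fun i => Homeomorph.mulLeft (a ^ (i : ℕ)) '' W) (by omega)
    (fun i => hhomeo W _ ⟨(Homeomorph.mulLeft (a ^ (i : ℕ))).image W⟩ hCW) fun g => ?_
  obtain ⟨k, hk, hg⟩ := hN g
  refine ⟨⟨k, by omega⟩, ?_⟩
  have := (Homeomorph.mulLeft (a ^ k)).isOpenMap.image_mem_nhds (mem_interior_iff_mem_nhds.1 hg)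
  simpa using this
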